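/- For an integer $k \ge 2$, let $r(k)$ denote the (diagonal) Ramsey number, that is, the least integer $N$ such that every coloring of the edges of the complete graph $K_N$ with two colors contains a monochromatic copy of $K_k$. Let $\eta = \frac{1}{8000}$. Then, for all sufficiently large integers $k$, $$r(k) \le 2^{(2-\eta^2/10)k}.$$ -/

import Mathlib

/-- `HasMonoClique N k` holds when every coloring of the edges of the complete graph on `N` vertices
with two colors contains a monochromatic copy of the complete graph on `k` vertices. -/
def HasMonoClique (N k : ℕ) : Prop :=
  ∀ C : SimpleGraph.TopEdgeLabeling (Fin N) Bool,
    ∃ (color : Bool) (S : Finset (Fin N)), (C.labelGraph color).IsNClique k S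

/-- The diagonal Ramsey number `r(k)`: the least `N` such that every two-coloring of the edges of
the complete graph on `N` vertices contains a monochromatic complete graph on `k` vertices. (The set
is never empty, see `hasMonoClique_ramseyNumber`.) -/
noncomputable def ramseyNumber (k : ℕ) : ℕ := sInf {N : ℕ | HasMonoClique N k}

/-- The finite Ramsey theorem for two colors, in off-diagonal form. -/
theorem exists_clique_or_clique (s t : ℕ) : ∃ N : ℕ, ∀ (V : Type) (G H : SimpleGraph V),
    (∀ v w : V, v ≠ w → G.Adj v w ∨ H.Adj v w) → ∀ S : Finset V, N ≤ S.card →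
      (∃ T ⊆ S, G.IsNClique s T) ∨ (∃ T ⊆ S, H.IsNClique t T) := by
  classical
  induction s generalizing t with
  | zero => exact ⟨0, fun V G H _ S _ => Or.inl ⟨∅, by simp, by simp [SimpleGraph.isNClique_iff]⟩⟩
  | succ s ihs =>
    induction t with
    | zero =>
      exact ⟨0, fun V G H _ S _ => Or.inr ⟨∅, by simp, by simp [SimpleGraph.isNClique_iff]⟩⟩
    | succ t iht =>
      obtain ⟨N₁, h₁⟩ := ihs (t + 1)
      obtain ⟨N₂, h₂⟩ := iht
      refine ⟨N₁ + N₂ + 1, fun V G H hGH S hS => ?_⟩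
      obtain ⟨v, hv⟩ : S.Nonempty := Finset.card_pos.mp (by omega)
      set A := (S.erase v).filter (fun w => G.Adj v w) with hA
      set B := (S.erase v).filter (fun w => ¬ G.Adj v w) with hB
      have hcard : A.card + B.card = S.card - 1 := by
        rw [hA, hB, Finset.card_filter_add_card_filter_not, Finset.card_erase_of_mem hv]
      have hAS : A ⊆ S := (Finset.filter_subset _ _).trans (Finset.erase_subset _ _)
      have hBS : B ⊆ S := (Finset.filter_subset _ _).trans (Finset.erase_subset _ _)
      by_cases hA' : N₁ ≤ A.card
      · rcases h₁ V G H hGH A hA' with ⟨T, hT, hc⟩ | ⟨T, hT, hc⟩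
        · refine Or.inl ⟨insert v T, Finset.insert_subset hv (hT.trans hAS), hc.insert ?_⟩
          intro w hw
          exact (Finset.mem_filter.mp (hT hw)).2
        · exact Or.inr ⟨T, hT.trans hAS, hc⟩
      · rcases h₂ V G H hGH B (by omega) with ⟨T, hT, hc⟩ | ⟨T, hT, hc⟩
        · exact Or.inl ⟨T, hT.trans hBS, hc⟩
        · refine Or.inr ⟨insert v T, Finset.insert_subset hv (hT.trans hBS), hc.insert ?_⟩
          intro w hw
          have hw' := Finset.mem_filter.mp (hT hw)
          exact (hGH v w (Finset.ne_of_mem_erase hw'.1).symm).resolve_left hw'.2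

/-- The minimum in the definition of `ramseyNumber` is attained. -/
theorem hasMonoClique_ramseyNumber (k : ℕ) : HasMonoClique (ramseyNumber k) k := by
  refine Nat.sInf_mem (s := {N : ℕ | HasMonoClique N k}) ?_
  obtain ⟨N, hN⟩ := exists_clique_or_clique k k
  refine ⟨N, fun C => ?_⟩
  have key : ∀ v w : Fin N, v ≠ w →
      (C.labelGraph true).Adj v w ∨ (C.labelGraph false).Adj v w := by
    intro v w hvw
    rw [SimpleGraph.TopEdgeLabeling.labelGraph_adj, SimpleGraph.TopEdgeLabeling.labelGraph_adj]
    cases h : C.get v w hvw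
    · exact Or.inr ⟨hvw, h⟩
    · exact Or.inl ⟨hvw, h⟩
  rcases hN _ _ _ key Finset.univ (by simp) with ⟨T, -, hT⟩ | ⟨T, -, hT⟩
  · exact ⟨true, T, hT⟩
  · exact ⟨false, T, hT⟩

/-! The Erdős–Szekeres bound is improved by building a large monochromatic book and then exploiting
that the clique sizes still needed among its pages are off-diagonal. A vertex with noticeably
unbalanced degrees lets one pass to its larger neighbourhood and gain on Erdős–Szekeres; about `k /
40000` such gains make up the deficit (`hasCliqueIn_of_balanced`). Otherwise one reaches a set `W`
in which every vertex has density almost 1/2 in both colours. There one finds a book with spine of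
size `t = k / 2000` and roughly `2 ^ (-t) * |W|` pages. Among the pages cliques of sizes about `k -
t` and `k` suffice, and Erdős–Szekeres with tilted weights gains about `exp (t ^ 2 / (4 * k))`,
which exceeds all losses.

The book comes from `exists_book`, whose engine is a geometric lemma. Trim the neighbourhoods of the
vertices of `X` in each `Y i` to a common size; inner products of their centred indicators form Gram
kernels. A power series in two such kernels with nonnegative coefficients has nonnegative sum over
all pairs. Applied to `pairTest`, which is at most -3 when one argument is below -3 and grows only
like the exponential of a square root, this gives an `n` such that a fraction of order `exp (-2√n)`
of all pairs are correlated to level `n - 1` in one colour and not badly anticorrelated in either.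
For small `n` a vertex joins a spine and densities barely drop. For large `n` a density is boosted,
and the gain pays for the loss of `2√n` in `log |X|`. -/

/-! ### Gram kernels -/

/-- A kernel which on `X` is a finite sum of kernels `φ u * φ v`. -/
def IsGramOn {α : Type} (X : Finset α) (z : α → α → ℝ) : Prop :=
  ∃ (I : Type) (s : Finset I) (φ : I → α → ℝ),
    ∀ u ∈ X, ∀ v ∈ X, z u v = ∑ i ∈ s, φ i u * φ i v

namespace IsGramOn

variable {α : Type} {X : Finset α} {z z' : α → α → ℝ}

theorem one : IsGramOn X (fun _ _ => 1) :=
  ⟨Unit, Finset.univ, fun _ _ => 1, by simp⟩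

theorem mul (h : IsGramOn X z) (h' : IsGramOn X z') : IsGramOn X (fun u v => z u v * z' u v) := by
  obtain ⟨I, s, φ, hφ⟩ := h
  obtain ⟨J, s', ψ, hψ⟩ := h'
  refine ⟨I × J, s ×ˢ s', fun p u => φ p.1 u * ψ p.2 u, fun u hu v hv => ?_⟩
  simp only [hφ u hu v hv, hψ u hu v hv, Finset.sum_mul_sum, Finset.sum_product]
  exact Finset.sum_congr rfl fun i _ => Finset.sum_congr rfl fun j _ => by ring

theorem pow (h : IsGramOn X z) (n : ℕ) : IsGramOn X (fun u v => z u v ^ n) := by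
  induction n with
  | zero => simpa using one
  | succ n ih => simpa only [pow_succ] using ih.mul h

theorem const_mul (h : IsGramOn X z) {c : ℝ} (hc : 0 ≤ c) : IsGramOn X (fun u v => c * z u v) := by
  obtain ⟨I, s, φ, hφ⟩ := h
  refine ⟨I, s, fun i u => √c * φ i u, fun u hu v hv => ?_⟩
  simp only [hφ u hu v hv, Finset.mul_sum]
  refine Finset.sum_congr rfl fun i _ => ?_
  rw [mul_mul_mul_comm, Real.mul_self_sqrt hc]

theorem sum_nonneg (h : IsGramOn X z) : 0 ≤ ∑ u ∈ X, ∑ v ∈ X, z u v := by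
  obtain ⟨I, s, φ, hφ⟩ := h
  have : ∑ u ∈ X, ∑ v ∈ X, z u v = ∑ i ∈ s, (∑ u ∈ X, φ i u) * (∑ v ∈ X, φ i v) := by
    rw [Finset.sum_congr rfl fun u hu => Finset.sum_congr rfl fun v hv => hφ u hu v hv]
    simp only [Finset.sum_mul_sum]
    rw [Finset.sum_comm]
    simp only [Finset.sum_comm (s := X) (t := s)]
    exact Finset.sum_congr rfl fun i _ => Finset.sum_comm
  rw [this]
  exact Finset.sum_nonneg fun i _ => mul_self_nonneg _

end IsGramOn

/-! ### The test function -/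

/-- The entire function `2 + cosh √x`. -/
noncomputable def coshSqrt (x : ℝ) : ℝ :=
  if 0 ≤ x then 2 + Real.cosh √x else 2 + Real.cos √(-x)

/-- One power series with positive coefficients serves both signs of `x`: that gives positivity on
Gram kernels, while the cosine form bounds the function for negative `x`. -/
theorem hasSum_coshSqrt (x : ℝ) :
    HasSum (fun n : ℕ => x ^ n / (2 * n).factorial) (coshSqrt x - 2) := by
  unfold coshSqrt
  split_ifs with h
  · have := Real.hasSum_cosh √x
    simpa [pow_mul, Real.sq_sqrt h] using this
  · have := Real.hasSum_cos √(-x)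
    simp only [pow_mul, Real.sq_sqrt (show 0 ≤ -x by linarith), ← mul_pow] at this
    simpa using this

theorem coshSqrt_mem_of_neg {x : ℝ} (hx : x < 0) : 1 ≤ coshSqrt x ∧ coshSqrt x ≤ 3 := by
  rw [coshSqrt, if_neg (by linarith)]
  constructor
  · linarith [Real.neg_one_le_cos √(-x)]
  · linarith [Real.cos_le_one √(-x)]

theorem le_coshSqrt {x : ℝ} (hx : 0 ≤ x) : 3 + x / 2 + x ^ 2 / 24 ≤ coshSqrt x := by
  have := sum_le_hasSum (Finset.range 3) (fun n _ => by positivity) (hasSum_coshSqrt x)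
  simp only [Finset.sum_range_succ, Finset.sum_range_zero] at this
  norm_num [Nat.factorial] at this
  linarith

theorem coshSqrt_le_exp {x : ℝ} (hx : 0 ≤ x) : coshSqrt x ≤ 3 * Real.exp √x := by
  rw [coshSqrt, if_pos hx, Real.cosh_eq]
  have h1 : 1 ≤ Real.exp √x := Real.one_le_exp (Real.sqrt_nonneg x)
  have h2 : Real.exp (-√x) ≤ 1 := Real.exp_le_one_iff.2 (by simp)
  linarith

theorem one_le_coshSqrt (x : ℝ) : 1 ≤ coshSqrt x := by
  rcases lt_or_ge x 0 with h | h
  · exact (coshSqrt_mem_of_neg h).1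
  · nlinarith [le_coshSqrt h]

theorem coshSqrt_le_of_le {x y : ℝ} (hy : 0 ≤ y) (h : x ≤ y) : coshSqrt x ≤ coshSqrt y := by
  rcases lt_or_ge x 0 with hx | hx
  · nlinarith [(coshSqrt_mem_of_neg hx).2, le_coshSqrt hy]
  · rw [coshSqrt, coshSqrt, if_pos hx, if_pos hy]
    gcongr
    rw [Real.cosh_le_cosh, abs_of_nonneg (Real.sqrt_nonneg _), abs_of_nonneg (Real.sqrt_nonneg _)]
    exact Real.sqrt_le_sqrt h

/-- The test function whose expectation over pairs of vertices is nonnegative. -/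
noncomputable def pairTest (x y : ℝ) : ℝ := x * coshSqrt y + y * coshSqrt x

theorem pairTest_comm (x y : ℝ) : pairTest x y = pairTest y x := by
  unfold pairTest; ring

/-- The summand 2 in `coshSqrt` keeps it at least 1, so a negative `x` is never annihilated. For `y
≥ 0` the term `y * coshSqrt x ≤ 3 * y` is beaten by the quadratic growth of `coshSqrt y`. -/
theorem pairTest_le_neg_three {x : ℝ} (y : ℝ) (hx : x < -3) : pairTest x y ≤ -3 := by
  unfold pairTest
  obtain ⟨h1, h3⟩ := coshSqrt_mem_of_neg (show x < 0 by linarith)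
  rcases lt_or_ge y 0 with hy | hy
  · nlinarith [one_le_coshSqrt y]
  · have := le_coshSqrt hy
    have h4 : x * coshSqrt y ≤ -3 * (3 + y / 2 + y ^ 2 / 24) := by nlinarith
    have h5 : y * coshSqrt x ≤ y * 3 := by gcongr
    nlinarith [sq_nonneg (y - 6)]

theorem pairTest_le {x y M : ℝ} (hM : 0 ≤ M) (hx : x ≤ M) (hy : y ≤ M) :
    pairTest x y ≤ 6 * M * Real.exp √M := by
  have key : ∀ a b : ℝ, a ≤ M → b ≤ M → a * coshSqrt b ≤ 3 * M * Real.exp √M := by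
    intro a b ha hb
    have h1 := coshSqrt_le_of_le hM hb
    have h2 := coshSqrt_le_exp hM
    have h3 := one_le_coshSqrt b
    calc a * coshSqrt b ≤ M * coshSqrt b := by gcongr
      _ ≤ M * (3 * Real.exp √M) := by gcongr; linarith
      _ = _ := by ring
  unfold pairTest
  linarith [key x y hx hy, key y x hy hx]

/-- Products of Gram kernels are Gram kernels (Schur), so each term of the Taylor expansion of the
test function has a nonnegative sum. -/
theorem IsGramOn.sum_pairTest_nonneg {α : Type} {X : Finset α} {z z' : α → α → ℝ}
    (h : IsGramOn X z) (h' : IsGramOn X z') :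
    0 ≤ ∑ u ∈ X, ∑ v ∈ X, pairTest (z u v) (z' u v) := by
  have key : ∀ {z z' : α → α → ℝ}, IsGramOn X z → IsGramOn X z' →
      0 ≤ ∑ u ∈ X, ∑ v ∈ X, z u v * coshSqrt (z' u v) := by
    intro z z' h h'
    have hs : HasSum (fun n : ℕ => ∑ u ∈ X, ∑ v ∈ X, z u v * (z' u v ^ n / (2 * n).factorial))
        (∑ u ∈ X, ∑ v ∈ X, z u v * (coshSqrt (z' u v) - 2)) :=
      hasSum_sum fun u _ => hasSum_sum fun v _ => (hasSum_coshSqrt _).mul_left _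
    have h1 := hs.nonneg fun n => by
      have := ((h.mul (h'.pow n)).const_mul
        (c := 1 / ((2 * n).factorial : ℝ)) (by positivity)).sum_nonneg
      refine this.trans_eq (Finset.sum_congr rfl fun u _ => Finset.sum_congr rfl fun v _ => ?_)
      ring
    have h2 := h.sum_nonneg
    have h3 : ∑ u ∈ X, ∑ v ∈ X, z u v * coshSqrt (z' u v) =
        ∑ u ∈ X, ∑ v ∈ X, z u v * (coshSqrt (z' u v) - 2) + 2 * ∑ u ∈ X, ∑ v ∈ X, z u v := by
      simp only [Finset.mul_sum, ← Finset.sum_add_distrib]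
      exact Finset.sum_congr rfl fun u _ => Finset.sum_congr rfl fun v _ => by ring
    rw [h3]; positivity
  have h1 := key h h'
  have h2 := key h' h
  simp only [pairTest, Finset.sum_add_distrib]
  exact add_nonneg h1 h2

/-! ### Correlated pairs -/

/-- Since √3 ≤ 1.74 < 2, a factor `exp (0.26 * √n)` is left over; its sixth Taylor term absorbs the
polynomial. At `n = 0` both sides are 0, by division by zero. -/
theorem mul_exp_sqrt_le {n : ℕ} :
    18 * (n : ℝ) * Real.exp √(3 * n) * (1e-8 * Real.exp (-2 * √n)) ≤
      1 / ((n : ℝ) * (n + 1)) := by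
  rcases Nat.eq_zero_or_pos n with rfl | hn
  · simp
  have hn' : (1 : ℝ) ≤ n := by exact_mod_cast hn
  set s := √(n : ℝ) with hs
  have hs0 : 0 ≤ s := Real.sqrt_nonneg _
  have hsn : s ^ 2 = n := Real.sq_sqrt (by positivity)
  have h1 : √(3 * (n : ℝ)) ≤ 1.74 * s := by
    rw [Real.sqrt_le_left (by positivity), mul_pow, hsn]; linarith
  have h2 := Real.pow_div_factorial_le_exp (x := 0.26 * s) (by positivity) 6
  have h3 : (n : ℝ) ^ 2 * (n + 1) ≤ 2 * s ^ 6 := by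
    rw [show s ^ 6 = (s ^ 2) ^ 3 by ring, hsn]; nlinarith [sq_nonneg (n : ℝ)]
  have h4 : Real.exp √(3 * n) * Real.exp (-2 * s) * Real.exp (0.26 * s) ≤ 1 := by
    rw [← Real.exp_add, ← Real.exp_add, Real.exp_le_one_iff]; linarith
  rw [le_div_iff₀ (by positivity)]
  have h5 : 18e-8 * ((n : ℝ) ^ 2 * (n + 1)) ≤ Real.exp (0.26 * s) := by
    refine le_trans ?_ h2
    norm_num [Nat.factorial, mul_pow]
    nlinarith [pow_nonneg hs0 6]
  calc _ = Real.exp √(3 * n) * Real.exp (-2 * s) * (18e-8 * ((n : ℝ) ^ 2 * (n + 1))) := by ring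
    _ ≤ Real.exp √(3 * n) * Real.exp (-2 * s) * Real.exp (0.26 * s) := by gcongr
    _ ≤ 1 := h4

theorem sum_one_div_mul_succ_le (L : ℕ) :
    ∑ n ∈ Finset.range L, 1 / ((n : ℝ) * (n + 1)) ≤ 1 := by
  have : ∀ L : ℕ, ∑ n ∈ Finset.range (L + 1), 1 / ((n : ℝ) * (n + 1)) = 1 - 1 / (L + 1) := by
    intro L
    induction L with
    | zero => simp
    | succ L ih => rw [Finset.sum_range_succ, ih]; push_cast; field_simp; ring
  cases L with
  | zero => simp
  | succ L => rw [this]; have : (0 : ℝ) ≤ 1 / (L + 1) := by positivity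
              linarith

-- If every level `n` were rare, the positive part of the test function would be too small to
-- balance the value -3 taken on badly anticorrelated pairs.
open Classical in
theorem exists_many_correlated_pairs {α : Type} {X : Finset α} (hX : X.Nonempty)
    {z : Bool → α → α → ℝ} (hz : ∀ i, IsGramOn X (z i)) :
    ∃ n : ℕ, 1e-8 * Real.exp (-2 * √n) * ((X ×ˢ X).card : ℝ) ≤
      ((X ×ˢ X).filter fun p => (∀ i, -1 ≤ z i p.1 p.2) ∧ ∃ i, (n : ℝ) - 1 ≤ z i p.1 p.2).card := by
  by_contra! hcon
  set P := X ×ˢ X with hP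
  set E : ℕ → Finset (α × α) := fun n =>
    P.filter fun p => (∀ i, -1 ≤ z i p.1 p.2) ∧ ∃ i, (n : ℝ) - 1 ≤ z i p.1 p.2 with hE
  set F : ℕ → ℝ := fun n => 18 * (n : ℝ) * Real.exp √(3 * n) with hF
  have hF0 : ∀ n, 0 ≤ F n := fun n => by positivity
  set N : α × α → ℕ := fun p => ⌈max (z true p.1 p.2) (z false p.1 p.2)⌉₊ with hN
  set L := P.sup N + 1 with hL
  -- The factor 3 moves the threshold -3 of the test function to -1 for `z`.
  have hsum : 0 ≤ ∑ p ∈ P, pairTest (3 * z true p.1 p.2) (3 * z false p.1 p.2) := by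
    rw [hP, Finset.sum_product]
    exact ((hz true).const_mul (by norm_num)).sum_pairTest_nonneg
      ((hz false).const_mul (by norm_num))
  -- A pair that is not badly anticorrelated is charged to the level `N p`, the rounded-up maximum.
  -- Summing gives `0 ≤ (-3 + 3e-8 + 1) * |P|`, a contradiction.
  have hpt : ∀ p ∈ P, pairTest (3 * z true p.1 p.2) (3 * z false p.1 p.2) ≤
      -3 + (if p ∈ E 0 then 3 else 0) +
        ∑ n ∈ Finset.range L, if p ∈ E n then F n else 0 := by
    intro p hp
    have hnn : 0 ≤ ∑ n ∈ Finset.range L, if p ∈ E n then F n else 0 :=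
      Finset.sum_nonneg fun n _ => by split_ifs <;> simp [hF0]
    by_cases hgood : ∀ i, -1 ≤ z i p.1 p.2
    · have h0 : p ∈ E 0 := by
        simp only [hE, Finset.mem_filter]
        exact ⟨hp, hgood, true, by simpa using hgood true⟩
      rw [if_pos h0]
      have hmem : p ∈ E (N p) := by
        simp only [hE, Finset.mem_filter]
        refine ⟨hp, hgood, ?_⟩
        by_contra! hlt
        have h1 : max (z true p.1 p.2) (z false p.1 p.2) < (N p : ℝ) - 1 :=
          max_lt (hlt true) (hlt false)
        have h2 : (0 : ℝ) ≤ max (z true p.1 p.2) (z false p.1 p.2) := by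
          by_contra! hneg
          have : N p = 0 := Nat.ceil_eq_zero.2 hneg.le
          rw [this] at h1
          have h3 := hgood true
          simp at h1; linarith [h1.1]
        have h3 : (N p : ℝ) < _ + 1 := Nat.ceil_lt_add_one h2
        linarith
      have hle : max (z true p.1 p.2) (z false p.1 p.2) ≤ (N p : ℝ) := Nat.le_ceil _
      have h1 : pairTest (3 * z true p.1 p.2) (3 * z false p.1 p.2) ≤ F (N p) := by
        refine (pairTest_le (M := 3 * (N p : ℝ)) (by positivity) ?_ ?_).trans_eq ?_
        · linarith [le_max_left (z true p.1 p.2) (z false p.1 p.2)]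
        · linarith [le_max_right (z true p.1 p.2) (z false p.1 p.2)]
        · simp only [hF]; ring
      have h2 : F (N p) ≤ ∑ n ∈ Finset.range L, if p ∈ E n then F n else 0 := by
        have := Finset.single_le_sum (f := fun n => if p ∈ E n then F n else 0)
          (s := Finset.range L) (fun n _ => by split_ifs <;> simp [hF0]) (a := N p)
          (Finset.mem_range.2 (Nat.lt_succ_of_le (Finset.le_sup hp)))
        simpa only [if_pos hmem] using this
      linarith
    · have h1 : pairTest (3 * z true p.1 p.2) (3 * z false p.1 p.2) ≤ -3 := by
        push Not at hgood
        obtain ⟨i, hi⟩ := hgood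
        cases i
        · rw [pairTest_comm]; exact pairTest_le_neg_three _ (by linarith)
        · exact pairTest_le_neg_three _ (by linarith)
      have h2 : (0 : ℝ) ≤ if p ∈ E 0 then 3 else 0 := by split_ifs <;> simp
      linarith
  have hle := hsum.trans (Finset.sum_le_sum hpt)
  have hcount : ∀ (n : ℕ) (c : ℝ), ∑ p ∈ P, (if p ∈ E n then c else 0) = c * (E n).card := by
    intro n c
    rw [← Finset.sum_filter, Finset.sum_const, nsmul_eq_mul, mul_comm]
    congr 3
    ext p; simp only [hE, Finset.mem_filter]; tauto
  rw [Finset.sum_add_distrib, Finset.sum_add_distrib, Finset.sum_comm, hcount] at hle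
  simp only [hcount, Finset.sum_const, nsmul_eq_mul] at hle
  have hP0 : (0 : ℝ) < P.card := by
    exact_mod_cast Finset.card_pos.2 (hX.product hX)
  have h0 := hcon 0
  simp only [Nat.cast_zero, Real.sqrt_zero, mul_zero, Real.exp_zero] at h0
  have h0' : ((E 0).card : ℝ) ≤ 1e-8 * P.card := by
    simp only [hE, Nat.cast_zero]; linarith
  have hn : ∑ n ∈ Finset.range L, F n * (E n).card ≤ P.card := by
    calc ∑ n ∈ Finset.range L, F n * (E n).card
        ≤ ∑ n ∈ Finset.range L, 1 / ((n : ℝ) * (n + 1)) * P.card := by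
          refine Finset.sum_le_sum fun n _ => ?_
          calc F n * (E n).card ≤ F n * (1e-8 * Real.exp (-2 * √n) * P.card) :=
                mul_le_mul_of_nonneg_left (hcon n).le (hF0 n)
            _ = 18 * (n : ℝ) * Real.exp √(3 * n) * (1e-8 * Real.exp (-2 * √n)) * P.card := by
                simp only [hF]; ring
            _ ≤ _ := by gcongr; exact mul_exp_sqrt_le
      _ = (∑ n ∈ Finset.range L, 1 / ((n : ℝ) * (n + 1))) * P.card := by rw [Finset.sum_mul]
      _ ≤ 1 * P.card := by gcongr; exact sum_one_div_mul_succ_le L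
      _ = _ := one_mul _
  norm_num at hle h0'
  linarith

open Classical in
/-- There are a vertex `x` and many `y`, all correlated with `x` to a level `n - 1` in one colour and
not too anticorrelated in either colour. -/
theorem exists_correlated_subset {α : Type} {X : Finset α} (hX : X.Nonempty)
    {z : Bool → α → α → ℝ} (hz : ∀ i, IsGramOn X (z i)) :
    ∃ n : ℕ, ∃ i : Bool, ∃ x ∈ X, ∃ X' ⊆ X,
      5e-9 * Real.exp (-2 * √n) * (X.card : ℝ) ≤ X'.card ∧
      ∀ y ∈ X', (∀ j, -1 ≤ z j x y) ∧ (n : ℝ) - 1 ≤ z i x y := by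
  obtain ⟨n, hn⟩ := exists_many_correlated_pairs hX hz
  refine ⟨n, ?_⟩
  by_contra! hcon
  set T : Bool → α → Finset α := fun i x =>
    X.filter fun y => (∀ j, -1 ≤ z j x y) ∧ (n : ℝ) - 1 ≤ z i x y with hT
  -- Pigeonhole over the two colours and the first vertex: the constant 5e-9 is half of 1e-8.
  have hlt : ∀ i, ∀ x ∈ X, ((T i x).card : ℝ) < 5e-9 * Real.exp (-2 * √n) * (X.card : ℝ) := by
    intro i x hx
    by_contra! h
    obtain ⟨y, hy, hy'⟩ := hcon i x hx (T i x) (Finset.filter_subset _ _) h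
    have := (Finset.mem_filter.1 hy).2
    exact absurd this.2 (hy' this.1).not_ge
  have hsub : ((X ×ˢ X).filter fun p => (∀ i, -1 ≤ z i p.1 p.2) ∧
      ∃ i, (n : ℝ) - 1 ≤ z i p.1 p.2).card ≤ ∑ x ∈ X, ((T true x).card + (T false x).card) := by
    rw [Finset.card_filter, Finset.sum_product]
    refine Finset.sum_le_sum fun x _ => ?_
    rw [← Finset.card_filter]
    refine le_trans (Finset.card_le_card ?_) (Finset.card_union_le _ _)
    intro y
    simp only [hT, Finset.mem_filter, Finset.mem_union]
    rintro ⟨hy, hg, i, hi⟩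
    cases i
    · exact Or.inr ⟨hy, hg, hi⟩
    · exact Or.inl ⟨hy, hg, hi⟩
  have h1 : (∑ x ∈ X, (((T true x).card : ℝ) + (T false x).card)) <
      ∑ x ∈ X, (1e-8 * Real.exp (-2 * √n) * (X.card : ℝ)) :=
    Finset.sum_lt_sum_of_nonempty hX fun x hx => by
      have h1 := hlt true x hx
      have h2 := hlt false x hx
      norm_num at h1 h2 ⊢; linarith
  have h2 : ((∑ x ∈ X, ((T true x).card + (T false x).card) : ℕ) : ℝ) =
      ∑ x ∈ X, (((T true x).card : ℝ) + (T false x).card) := by push_cast; rfl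
  rw [Finset.sum_const, nsmul_eq_mul] at h1
  rw [Finset.card_product] at hn
  push_cast at hn
  have h3 : ((((X ×ˢ X).filter fun p => (∀ i, -1 ≤ z i p.1 p.2) ∧
      ∃ i, (n : ℝ) - 1 ≤ z i p.1 p.2).card : ℕ) : ℝ) ≤
      ((∑ x ∈ X, ((T true x).card + (T false x).card) : ℕ) : ℝ) := by exact_mod_cast hsub
  linarith [h2]

open Classical in
/-- `exists_correlated_subset` for the intersections of sets of prescribed size. -/
theorem exists_step {α : Type} {X : Finset α} (hX : X.Nonempty) {Y : Bool → Finset α}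
    {S : Bool → α → Finset α} {m : Bool → ℕ} {c : Bool → ℝ} (hS : ∀ i, ∀ x ∈ X, S i x ⊆ Y i)
    (hm : ∀ i, ∀ x ∈ X, (S i x).card = m i) (hm0 : ∀ i, 0 < m i) (hc : ∀ i, 0 < c i) :
    ∃ n : ℕ, ∃ i : Bool, ∃ x ∈ X, ∃ X' ⊆ X,
      5e-9 * Real.exp (-2 * √n) * (X.card : ℝ) ≤ X'.card ∧
      ∀ y ∈ X', (∀ j, (m j / (Y j).card - c j) * m j ≤ (S j x ∩ S j y).card) ∧
        (m i / (Y i).card + (n - 1) * c i) * m i ≤ (S i x ∩ S i y).card := by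
  set z : Bool → α → α → ℝ := fun i u v =>
    1 / (c i * m i) * ((S i u ∩ S i v).card - (m i : ℝ) / (Y i).card * m i) with hz
  have hgram : ∀ i, IsGramOn X (z i) := by
    intro i
    refine IsGramOn.const_mul (z := fun u v =>
      ((S i u ∩ S i v).card : ℝ) - (m i : ℝ) / (Y i).card * m i) ?_ ?_
    -- Indicators centred at their mean `m i / |Y i|`: the cross terms combine to `-m i ^ 2 / |Y i|`
    -- only because all `S i u` have the same size.
    · refine ⟨α, Y i, fun y u => (if y ∈ S i u then 1 else 0) - (m i : ℝ) / (Y i).card,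
        fun u hu v hv => ?_⟩
      have hcard : ∀ u ∈ X, ∑ y ∈ Y i, (if y ∈ S i u then (1 : ℝ) else 0) = m i := by
        intro u hu
        rw [Finset.sum_ite_mem, Finset.inter_eq_right.2 (hS i u hu)]
        simp [hm i u hu]
      have hcard2 : ∑ y ∈ Y i, (if y ∈ S i u then (1 : ℝ) else 0) *
          (if y ∈ S i v then (1 : ℝ) else 0) = (S i u ∩ S i v).card := by
        simp only [← ite_and, mul_ite, mul_one, mul_zero]
        rw [← Finset.sum_filter, Finset.sum_const, nsmul_eq_mul, mul_one]
        congr 2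
        ext y
        simp only [Finset.mem_filter, Finset.mem_inter]
        exact ⟨fun h => ⟨h.2.2, h.2.1⟩, fun h => ⟨hS i u hu h.1, h.2, h.1⟩⟩
      have hY : ((Y i).card : ℝ) ≠ 0 := by
        have := (hm0 i).trans_le ((hm i u hu).symm.le.trans (Finset.card_le_card (hS i u hu)))
        positivity
      have : ∀ y, ((if y ∈ S i u then 1 else 0) - (m i : ℝ) / (Y i).card) *
          ((if y ∈ S i v then 1 else 0) - (m i : ℝ) / (Y i).card) =
          (if y ∈ S i u then (1 : ℝ) else 0) * (if y ∈ S i v then (1 : ℝ) else 0) -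
          (m i : ℝ) / (Y i).card * (if y ∈ S i u then (1 : ℝ) else 0) -
          (m i : ℝ) / (Y i).card * (if y ∈ S i v then (1 : ℝ) else 0) +
          ((m i : ℝ) / (Y i).card) ^ 2 := fun y => by ring
      simp only [this, Finset.sum_add_distrib, Finset.sum_sub_distrib, ← Finset.mul_sum,
        hcard u hu, hcard v hv, hcard2, Finset.sum_const, nsmul_eq_mul]
      field_simp
      ring
    · have := hm0 i; have := hc i; positivity
  obtain ⟨n, i, x, hx, X', hX', hcard, h⟩ := exists_correlated_subset hX hgram
  have conv : ∀ j y (r : ℝ), r ≤ z j x y →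
      (m j / (Y j).card + r * c j) * m j ≤ (S j x ∩ S j y).card := by
    intro j y r hr
    have h1 : (0 : ℝ) < m j := by exact_mod_cast hm0 j
    have h2 := hc j
    simp only [hz] at hr
    rw [one_div, inv_mul_eq_div, le_div_iff₀ (by positivity)] at hr
    linarith
  refine ⟨n, i, x, hx, X', hX', hcard, fun y hy => ⟨fun j => ?_, conv _ _ _ (h y hy).2⟩⟩
  have := conv j y (-1) ((h y hy).1 j)
  linarith

/-! ### The book algorithm -/

/-- A monochromatic book: a clique `T` of size `a`, completely joined to `M`. -/
def IsBook {V : Type} (G : SimpleGraph V) (a : ℕ) (T M : Finset V) : Prop :=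
  T.card = a ∧ G.IsClique T ∧ ∀ x ∈ T, ∀ y ∈ M, G.Adj x y

/-- The excess over `p` of the proportion `m / |Y|`. -/
noncomputable def excess {V : Type} (p : ℝ) (m : ℕ) (Y : Finset V) : ℝ := m / Y.card - p

open Classical in
theorem IsBook.insert {V : Type} {G : SimpleGraph V} {a : ℕ} {T M : Finset V} (h : IsBook G a T M)
    {x : V} (hT : ∀ y ∈ T, G.Adj x y) (hM : ∀ y ∈ M, G.Adj x y) :
    IsBook G (a + 1) (insert x T) M := by
  obtain ⟨h1, h2, h3⟩ := h
  refine ⟨?_, ?_, ?_⟩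
  · rw [Finset.card_insert_of_notMem fun hx => (hT x hx).ne rfl, h1]
  · rw [Finset.coe_insert]
    exact h2.insert fun y hy _ => hT y hy
  · intro y hy z hz
    rcases Finset.mem_insert.1 hy with rfl | hy
    · exact hM z hz
    · exact h3 y hy z hz

theorem neg_two_div_le_log {t : ℝ} (ht : 2 ≤ t) : -(2 / t) ≤ Real.log (1 - 1 / t) := by
  have h : 0 < 1 - 1 / t := by
    rw [sub_pos, div_lt_one (by linarith)]; linarith
  refine le_trans ?_ (Real.one_sub_inv_le_log_of_pos h)
  have h1 : (1 - 1 / t)⁻¹ = t / (t - 1) := by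
    have : t - 1 ≠ 0 := by linarith
    field_simp
  rw [h1, one_sub_div (by linarith), ← neg_div, div_le_div_iff₀ (by linarith) (by linarith)]
  linarith

open Classical in
/-- One of the two halves of `X \ {x}` is large. -/
theorem exists_large_neighborhood {V : Type} {G : Bool → SimpleGraph V}
    (hG : ∀ v w, v ≠ w → ∃ i, (G i).Adj v w) (x : V) (X : Finset V) :
    ∃ j, X.card ≤ 2 * ((X.erase x).filter ((G j).Adj x)).card + 1 := by
  by_contra! h
  have h1 : X.card - 1 ≤ (X.erase x).card := Finset.pred_card_le_card_erase
  have h2 : (X.erase x).card ≤ ((X.erase x).filter ((G true).Adj x)).card +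
      ((X.erase x).filter ((G false).Adj x)).card := by
    refine le_trans (Finset.card_le_card fun y hy => ?_) (Finset.card_union_le _ _)
    obtain ⟨i, hi⟩ := hG x y (Finset.ne_of_mem_erase hy).symm
    cases i
    · exact Finset.mem_union_right _ (Finset.mem_filter.2 ⟨hy, hi⟩)
    · exact Finset.mem_union_left _ (Finset.mem_filter.2 ⟨hy, hi⟩)
  have := h true
  have := h false
  omega

theorem forall_update_bool {α : Type} {P : Bool → ℕ → ℕ → α → Prop} {m a : Bool → ℕ}
    {Y : Bool → α} {j : Bool} {m' a' : ℕ} {Y' : α} (h : P j m' a' Y')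
    (h' : P (!j) (m (!j)) (a (!j)) (Y (!j))) (i : Bool) :
    P i (Function.update m j m' i) (Function.update a j a' i) (Function.update Y j Y' i) := by
  cases i <;> cases j <;> simpa using by assumption

open Classical in
/-- If `X` is large and every vertex of `X` has degree at least `m i` in colour `i` to `Y i`, there
is a monochromatic book with spine in `X` and `a i` vertices, and pages in `Y i`. Either the degrees
to some `Y i` are boosted inside a smaller pair (`hlarge`, `hboost` pay for this), or a vertex is
added to the spine of one of the two books at cost `w` (`hsmall`). -/
theorem exists_book {V : Type} {G : Bool → SimpleGraph V}
    (hG : ∀ v w, v ≠ w → ∃ i, (G i).Adj v w) {t n₀ : ℕ} (ht : 2 ≤ t) {p δ κ ν w : ℝ}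
    (hp : 0 < p) (hp1 : p ≤ 1) (hδ : 0 < δ) (hκ : 0 ≤ κ) (hν : 0 ≤ ν) (hw : 0 < w)
    (hsmall : ∀ n < n₀, Real.exp (-w) ≤ 5e-9 * Real.exp (-2 * √(n : ℝ)) / 3)
    (hlarge : ∀ n : ℕ, n₀ ≤ n → ((n : ℝ) - 1) / t ≤ Real.exp 2 / δ →
      2 * √(n : ℝ) - Real.log 5e-9 ≤ κ * t * Real.log (1 + ((n : ℝ) - 1) / t))
    (hboost : ∀ n : ℕ, n₀ ≤ n → 1 ≤ ν * t * Real.log (1 + ((n : ℝ) - 1) / t)) (hn₀ : 2 ≤ n₀) :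
    ∀ (N : ℕ) (X : Finset V) (Y : Bool → Finset V) (m a : Bool → ℕ),
      X.card + ∑ i, (Y i).card ≤ N → (∀ i, m i ≤ (Y i).card) →
      (∀ i, ∀ x ∈ X, m i ≤ ((Y i).filter ((G i).Adj x)).card) →
      (∀ i, 0 < excess p (m i) (Y i)) →
      (∀ i, Real.log δ - 2 ≤ Real.log (excess p (m i) (Y i)) - 2 * a i / t) →
      (∑ i, (a i : ℝ)) * (w + 2 * κ) ≤
        Real.log X.card + κ * t * ∑ i, Real.log (excess p (m i) (Y i)) →
      ∃ i, ∃ T ⊆ X, ∃ M ⊆ Y i, IsBook (G i) (a i) T M ∧ 0 < M.card ∧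
        Real.log (Y i).card + ν * -Real.log p * t * Real.log (excess p (m i) (Y i)) -
          a i * (-Real.log p + 2 * ν * -Real.log p) ≤ Real.log M.card := by
  intro N
  induction N using Nat.strong_induction_on with
  | _ N ih =>
  intro X Y m a hN hm hdeg hD hD' hX
  set D : Bool → ℝ := fun i => excess p (m i) (Y i) with hDdef
  have hL : 0 ≤ -Real.log p := by have := Real.log_nonpos hp.le hp1; linarith
  have ht0 : (0 : ℝ) < t := by positivity
  have hY0 : ∀ i, 0 < (Y i).card := by
    intro i
    by_contra h
    have h := hD i
    have h0 : (Y i).card = 0 := by omega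
    rw [excess, h0] at h
    simp at h; linarith
  have hm0 : ∀ i, 0 < m i := by
    intro i
    by_contra h
    have h := hD i
    have h0 : m i = 0 := by omega
    rw [excess, h0] at h
    simp at h; linarith
  have hY0' : ∀ i, (0 : ℝ) < (Y i).card := fun i => by exact_mod_cast hY0 i
  have hm0' : ∀ i, (0 : ℝ) < m i := fun i => by exact_mod_cast hm0 i
  have hmY : ∀ i, (m i : ℝ) / (Y i).card = p + D i := fun i => by simp [hDdef, excess]
  have hD1 : ∀ i, D i ≤ 1 := by
    intro i
    have : (m i : ℝ) / (Y i).card ≤ 1 := div_le_one_of_le₀ (by exact_mod_cast hm i) (hY0' i).le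
    linarith [hmY i]
  have hlogD : ∀ i, Real.log (D i) ≤ 0 := fun i => Real.log_nonpos (hD i).le (hD1 i)
  have hlogm : ∀ i, Real.log (Y i).card - -Real.log p ≤ Real.log (m i) := by
    intro i
    have h1 : p ≤ m i / (Y i).card := by linarith [hmY i, hD i]
    have h2 := Real.log_le_log hp h1
    rw [Real.log_div (hm0' i).ne' (hY0' i).ne'] at h2
    linarith
  -- The process stops when one spine is complete: the empty spine remains to be found and all of `Y
  -- i` serves as pages.
  by_cases ha : ∃ i, a i = 0
  · obtain ⟨i, hi⟩ := ha
    refine ⟨i, ∅, Finset.empty_subset _, Y i, subset_rfl, ⟨by simp [hi], by simp, by simp⟩,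
      hY0 i, ?_⟩
    have : ν * -Real.log p * t * Real.log (D i) ≤ 0 :=
      mul_nonpos_of_nonneg_of_nonpos (by positivity) (hlogD i)
    simp only [hi, Nat.cast_zero, zero_mul, sub_zero]
    linarith
  push Not at ha
  have ha1 : ∀ i, (1 : ℝ) ≤ a i := fun i => by exact_mod_cast Nat.one_le_iff_ne_zero.2 (ha i)
  rw [Fintype.sum_bool, Fintype.sum_bool] at hX
  have hlogX : 2 * w ≤ Real.log X.card := by
    have h1 : κ * t * (Real.log (D true) + Real.log (D false)) ≤ 0 :=
      mul_nonpos_of_nonneg_of_nonpos (by positivity) (by linarith [hlogD true, hlogD false])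
    have h2 : 2 * (w + 2 * κ) ≤ ((a true : ℝ) + a false) * (w + 2 * κ) := by
      have := ha1 true; have := ha1 false; gcongr; linarith
    linarith
  have hX0 : 0 < X.card := by
    by_contra h
    have h0 : X.card = 0 := by omega
    rw [h0] at hlogX
    simp at hlogX; linarith
  have hX0' : (0 : ℝ) < X.card := by exact_mod_cast hX0
  have hXexp : Real.exp (2 * w) ≤ X.card := (Real.le_log_iff_exp_le hX0').1 hlogX
  -- The induction hypothesis after changing `X` and the data of the single colour `j`. A book found
  -- in the other colour is already the one wanted.
  have step : ∀ (j : Bool) (X' Y' : Finset V) (m' a' : ℕ), X' ⊆ X → Y' ⊆ Y j →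
      X'.card + Y'.card < X.card + (Y j).card →
      m' ≤ Y'.card → (∀ x ∈ X', m' ≤ (Y'.filter ((G j).Adj x)).card) → 0 < excess p m' Y' →
      Real.log δ - 2 ≤ Real.log (excess p m' Y') - 2 * a' / t →
      ((a' : ℝ) + a (!j)) * (w + 2 * κ) ≤
        Real.log X'.card + κ * t * (Real.log (excess p m' Y') + Real.log (D (!j))) →
      ((∃ T ⊆ X', ∃ M ⊆ Y', IsBook (G j) a' T M ∧ 0 < M.card ∧
        Real.log Y'.card + ν * -Real.log p * t * Real.log (excess p m' Y') -
          a' * (-Real.log p + 2 * ν * -Real.log p) ≤ Real.log M.card) ∨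
      ∃ i, ∃ T ⊆ X, ∃ M ⊆ Y i, IsBook (G i) (a i) T M ∧ 0 < M.card ∧
        Real.log (Y i).card + ν * -Real.log p * t * Real.log (D i) -
          a i * (-Real.log p + 2 * ν * -Real.log p) ≤ Real.log M.card) := by
    intro j X' Y' m' a' hX' hY' hlt hm' hdeg' hDp hDl hpot
    have hlt' : X'.card + ∑ i, (Function.update Y j Y' i).card < N := by
      refine lt_of_lt_of_le ?_ hN
      rw [Fintype.sum_bool, Fintype.sum_bool]
      clear * - hlt
      cases j <;> simp <;> omega
    obtain ⟨i, T, hT, M, hM, hb⟩ := ih _ hlt' X' (Function.update Y j Y')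
      (Function.update m j m') (Function.update a j a') le_rfl
      (forall_update_bool (a := a) (a' := a') (P := fun i m a (Y : Finset V) => m ≤ Y.card)
        hm' (hm _))
      (forall_update_bool (a := a) (a' := a') (P := fun i m a (Y : Finset V) =>
        ∀ x ∈ X', m ≤ (Y.filter ((G i).Adj x)).card) hdeg'
        fun x hx => hdeg _ x (hX' hx))
      (forall_update_bool (a := a) (a' := a') (P := fun i m a (Y : Finset V) => 0 < excess p m Y)
        hDp (hD _))
      (forall_update_bool (a := a) (a' := a') (P := fun i m a (Y : Finset V) =>
        Real.log δ - 2 ≤ Real.log (excess p m Y) - 2 * a / t) hDl (hD' _))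
      (by rw [Fintype.sum_bool, Fintype.sum_bool]
          simp only [hDdef] at hpot
          clear * - hpot
          cases j <;> simp at hpot ⊢ <;> linarith)
    by_cases hij : i = j
    · subst hij
      rw [Function.update_self] at hM
      simp only [Function.update_self] at hb
      exact Or.inl ⟨T, hT, M, hM, hb⟩
    · rw [Function.update_of_ne hij] at hM
      simp only [Function.update_of_ne hij] at hb
      exact Or.inr ⟨i, T, hT.trans hX', M, hM, hb⟩
  have hex : ∀ i x, ∃ s ⊆ (Y i).filter ((G i).Adj x), x ∈ X → s.card = m i := by
    intro i x
    by_cases hx : x ∈ X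
    · obtain ⟨s, hs, hc⟩ := Finset.exists_subset_card_eq (hdeg i x hx)
      exact ⟨s, hs, fun _ => hc⟩
    · exact ⟨∅, Finset.empty_subset _, fun h => absurd h hx⟩
  choose S hSsub hScard using hex
  have hSY : ∀ i x, S i x ⊆ Y i := fun i x => (hSsub i x).trans (Finset.filter_subset _ _)
  have hSadj : ∀ i x, ∀ y ∈ S i x, (G i).Adj x y := fun i x y hy =>
    (Finset.mem_filter.1 (hSsub i x hy)).2
  -- With `c i = D i / t`, anticorrelation of level -1 costs a factor `1 - 1 / t` of the excess,
  -- hence only a constant factor over `t` spine steps.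
  obtain ⟨n, i, x, hx, X', hX'X, hX'card, hX'⟩ := exists_step (Finset.card_pos.1 hX0) (S := S)
    (c := fun i => D i / t) (fun i x _ => hSY i x) (fun i x hx => hScard i x hx) hm0
    (fun i => div_pos (hD i) ht0)
  have hfilter : ∀ i y, S i x ∩ S i y ⊆ (S i x).filter ((G i).Adj y) := by
    intro i y z hz
    rw [Finset.mem_inter] at hz
    exact Finset.mem_filter.2 ⟨hz.1, hSadj i y z hz.2⟩
  rcases lt_or_ge n n₀ with hn | hn
  -- Spine step: `x` joins the spine of its majority colour `j` in `X'`, which need not be the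
  -- correlated colour `i`; only the lower bound on correlations is used.
  · obtain ⟨j, hj⟩ := exists_large_neighborhood hG x X'
    set X'' := (X'.erase x).filter ((G j).Adj x) with hX''
    have hX''X' : X'' ⊆ X' := (Finset.filter_subset _ _).trans (Finset.erase_subset _ _)
    have hw3 : 3 * Real.exp (-w) * X.card ≤ X'.card := by
      have h1 : 3 * Real.exp (-w) ≤ 5e-9 * Real.exp (-2 * √(n : ℝ)) := by linarith [hsmall n hn]
      exact le_trans (by gcongr) hX'card
    have h3 : 1 ≤ Real.exp (-w) * X.card := by
      calc (1 : ℝ) ≤ Real.exp w := Real.one_le_exp hw.le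
        _ = Real.exp (-w) * Real.exp (2 * w) := by rw [← Real.exp_add]; ring_nf
        _ ≤ _ := by gcongr
    have hX''big : Real.exp (-w) * X.card ≤ X''.card := by
      have : (X'.card : ℝ) ≤ 2 * X''.card + 1 := by exact_mod_cast hj
      linarith
    have hlogX'' : Real.log X.card - w ≤ Real.log X''.card := by
      have := Real.log_le_log (by positivity) hX''big
      rw [Real.log_mul (Real.exp_ne_zero _) hX0'.ne', Real.log_exp] at this
      linarith
    have hX''0 : X''.Nonempty := by
      rw [← Finset.card_pos, ← Nat.cast_pos (α := ℝ)]; linarith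
    set m' := ⌈((m j : ℝ) / (Y j).card - D j / t) * m j⌉₊ with hm'
    have hmle : ∀ y ∈ X'', m' ≤ (S j x ∩ S j y).card := fun y hy =>
      Nat.ceil_le.2 ((hX' y (hX''X' hy)).1 j)
    have hcard : (S j x).card = m j := hScard j x hx
    have hexc : D j * (1 - 1 / t) ≤ excess p m' (S j x) := by
      have h1 : ((m j : ℝ) / (Y j).card - D j / t) * m j ≤ m' := Nat.le_ceil _
      rw [← le_div_iff₀ (hm0' j), hmY] at h1
      rw [excess, hcard]
      have h2 : D j * (1 - 1 / t) = D j - D j / t := by ring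
      linarith
    have ht2 : (2 : ℝ) ≤ t := by exact_mod_cast ht
    have ht1 : 0 < 1 - 1 / (t : ℝ) := by
      rw [sub_pos, div_lt_one ht0]; linarith
    have hlogexc : Real.log (D j) - 2 / t ≤ Real.log (excess p m' (S j x)) := by
      have h1 := Real.log_le_log (mul_pos (hD j) ht1) hexc
      rw [Real.log_mul (hD j).ne' ht1.ne'] at h1
      linarith [neg_two_div_le_log ht2]
    have hcast : ((a j - 1 : ℕ) : ℝ) = a j - 1 := by
      have := Nat.one_le_iff_ne_zero.2 (ha j); push_cast [this]; ring
    have hpot : ((a j : ℝ) + a (!j)) * (w + 2 * κ) ≤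
        Real.log X.card + κ * t * (Real.log (D j) + Real.log (D (!j))) := by
      cases j <;> simp only [Bool.not_true, Bool.not_false] <;> linarith
    rcases step j X'' (S j x) m' (a j - 1) (hX''X'.trans hX'X) (hSY j x)
      (by
        have h1 : X''.card < X.card := Finset.card_lt_card
          ⟨hX''X'.trans hX'X, fun h => by simpa [hX''] using h hx⟩
        have h2 := Finset.card_le_card (hSY j x)
        omega)
      (by
        obtain ⟨y, hy⟩ := hX''0
        exact (hmle y hy).trans (Finset.card_le_card Finset.inter_subset_left))
      (by
        exact fun y hy => (hmle y hy).trans (Finset.card_le_card (hfilter j y)))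
      (by
        exact (mul_pos (hD j) ht1).trans_le hexc)
      (by
        rw [hcast]
        have := hD' j
        have h2 : 2 * ((a j : ℝ) - 1) / t = 2 * a j / t - 2 / t := by ring
        linarith)
      (by
        rw [hcast]
        have h1 : κ * t * (Real.log (D j) - 2 / t) ≤
            κ * t * Real.log (excess p m' (S j x)) := by gcongr
        have h2 : κ * t * (Real.log (D j) - 2 / t) = κ * t * Real.log (D j) - 2 * κ := by
          field_simp
        linarith) with h | h
    · obtain ⟨T, hT, M, hM, hb, hM0, hlog⟩ := h
      refine ⟨j, insert x T, Finset.insert_subset hx (hT.trans (hX''X'.trans hX'X)), M,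
        hM.trans (hSY j x), ?_, hM0, ?_⟩
      · have := hb.insert (x := x) (fun y hy => (Finset.mem_filter.1 (hT hy)).2)
          (fun y hy => hSadj j x y (hM hy))
        rwa [Nat.sub_add_cancel (Nat.one_le_iff_ne_zero.2 (ha j))] at this
      · refine le_trans ?_ hlog
        rw [hcast, hcard]
        have h1 : ν * -Real.log p * t * (Real.log (D j) - 2 / t) ≤
            ν * -Real.log p * t * Real.log (excess p m' (S j x)) := by gcongr
        have h2 : ν * -Real.log p * t * (Real.log (D j) - 2 / t) =
            ν * -Real.log p * t * Real.log (D j) - 2 * ν * -Real.log p := by field_simp; ring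
        linarith [hlogm j]
    · exact h
  · have hn2 : (2 : ℝ) ≤ n := by exact_mod_cast hn₀.trans hn
    -- Boost step: no vertex is added, `Y i` shrinks to `S i x`, and the excess grows by a factor of
    -- at least `1 + l / t`.
    set l : ℝ := (n : ℝ) - 1 with hl
    have hl1 : 1 ≤ l := by linarith
    have hl0 : 0 < 1 + l / t := by positivity
    have hX'0' : (0 : ℝ) < X'.card := lt_of_lt_of_le (by positivity) hX'card
    have hX'0 : X'.Nonempty := Finset.card_pos.1 (by exact_mod_cast hX'0')
    set m' := ⌈((m i : ℝ) / (Y i).card + l * (D i / t)) * m i⌉₊ with hm'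
    have hmle : ∀ y ∈ X', m' ≤ (S i x ∩ S i y).card := fun y hy =>
      Nat.ceil_le.2 (hX' y hy).2
    have hcard : (S i x).card = m i := hScard i x hx
    have hm'le : m' ≤ m i := by
      obtain ⟨y, hy⟩ := hX'0
      exact hcard ▸ (hmle y hy).trans (Finset.card_le_card Finset.inter_subset_left)
    have hm'1 : (m' : ℝ) / m i ≤ 1 := div_le_one_of_le₀ (by exact_mod_cast hm'le) (hm0' i).le
    have hm'2 : (m i : ℝ) / (Y i).card + l * (D i / t) ≤ m' / m i := by
      rw [le_div_iff₀ (hm0' i)]; exact Nat.le_ceil _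
    have hpos : 0 < l * (D i / t) := mul_pos (by linarith) (div_pos (hD i) ht0)
    have hexc : D i * (1 + l / t) ≤ excess p m' (S i x) := by
      rw [excess, hcard]
      have h2 : D i * (1 + l / t) = D i + l * (D i / t) := by ring
      linarith [hmY i]
    have hlogexc : Real.log (D i) + Real.log (1 + l / t) ≤ Real.log (excess p m' (S i x)) := by
      rw [← Real.log_mul (hD i).ne' hl0.ne']
      exact Real.log_le_log (mul_pos (hD i) hl0) hexc
    have hlog0 : 0 ≤ Real.log (1 + l / t) := by
      refine Real.log_nonneg ?_
      have : 0 ≤ l / t := by positivity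
      linarith
    -- The invariant `hD'` keeps the excess above `δ * exp (-2)`, and the boosted excess is at most
    -- 1.
    have hlt : l / t ≤ Real.exp 2 / δ := by
      have h1 : D i * (1 + l / t) ≤ 1 := by
        refine hexc.trans ?_
        rw [excess, hcard]; linarith
      have h2 : δ * Real.exp (-2) ≤ D i := by
        rw [← Real.log_le_log_iff (by positivity) (hD i),
          Real.log_mul hδ.ne' (Real.exp_ne_zero _), Real.log_exp]
        have h3 : 0 ≤ 2 * (a i : ℝ) / t := by positivity
        linarith [hD' i]
      rw [le_div_iff₀ hδ]
      have h3 : D i * (l / t) ≤ 1 := by linarith [hD i]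
      have h4 : δ * Real.exp (-2) * (l / t) ≤ 1 :=
        (mul_le_mul_of_nonneg_right h2 (by positivity)).trans h3
      calc l / t * δ = δ * Real.exp (-2) * (l / t) * Real.exp 2 := by
            rw [mul_right_comm, mul_assoc δ, ← Real.exp_add]; simp [mul_comm]
        _ ≤ 1 * Real.exp 2 := by gcongr
        _ = _ := one_mul _
    have hlogX' : Real.log X.card - (2 * √(n : ℝ) - Real.log 5e-9) ≤ Real.log X'.card := by
      have := Real.log_le_log (by positivity) hX'card
      rw [Real.log_mul (by positivity) hX0'.ne', Real.log_mul (by norm_num) (Real.exp_ne_zero _),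
        Real.log_exp] at this
      linarith
    have hpot : ((a i : ℝ) + a (!i)) * (w + 2 * κ) ≤
        Real.log X.card + κ * t * (Real.log (D i) + Real.log (D (!i))) := by
      cases i <;> simp only [Bool.not_true, Bool.not_false] <;> linarith
    rcases step i X' (S i x) m' (a i) hX'X (hSY i x)
      (by
        have h1 : X'.card ≤ X.card := Finset.card_le_card hX'X
        have h2 : (m i : ℝ) / (Y i).card < 1 := by linarith
        rw [div_lt_one (hY0' i)] at h2
        have h3 : m i < (Y i).card := by exact_mod_cast h2
        omega)
      (by
        rw [hcard]; exact hm'le)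
      (by
        exact fun y hy => (hmle y hy).trans (Finset.card_le_card (hfilter i y)))
      (by
        exact (mul_pos (hD i) hl0).trans_le hexc)
      (by
        have := hD' i
        linarith)
      (by
        have h1 : κ * t * (Real.log (D i) + Real.log (1 + l / t)) ≤
            κ * t * Real.log (excess p m' (S i x)) := by gcongr
        linarith [hlarge n hn hlt]) with h | h
    · obtain ⟨T, hT, M, hM, hb, hM0, hlog⟩ := h
      refine ⟨i, T, hT.trans hX'X, M, hM.trans (hSY i x), hb, hM0, le_trans ?_ hlog⟩
      rw [hcard]
      have h1 : ν * -Real.log p * t * (Real.log (D i) + Real.log (1 + l / t)) ≤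
          ν * -Real.log p * t * Real.log (excess p m' (S i x)) := by gcongr
      have h2 : -Real.log p * 1 ≤ -Real.log p * (ν * t * Real.log (1 + l / t)) :=
        mul_le_mul_of_nonneg_left (hboost n hn) hL
      linarith [hlogm i]
    · exact h

/-! ### Erdős–Szekeres and unbalanced degrees -/

/-- `W` contains a clique of colour `i` and size `b i`, for some `i`. -/
def HasCliqueIn {V : Type} (G : Bool → SimpleGraph V) (W : Finset V) (b : Bool → ℕ) : Prop :=
  ∃ i, ∃ T ⊆ W, (G i).IsNClique (b i) T

open Classical in
theorem HasCliqueIn.of_neighbors {V : Type} {G : Bool → SimpleGraph V} {W : Finset V}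
    {b : Bool → ℕ} {v : V} (hv : v ∈ W) {i : Bool} (hb : b i ≠ 0)
    (h : HasCliqueIn G (W.filter ((G i).Adj v)) (Function.update b i (b i - 1))) :
    HasCliqueIn G W b := by
  obtain ⟨j, T, hT, hc⟩ := h
  have hTW := hT.trans (Finset.filter_subset _ _)
  by_cases hj : j = i
  · subst hj
    rw [Function.update_self] at hc
    have := hc.insert (a := v) fun w hw => (Finset.mem_filter.1 (hT hw)).2
    rw [Nat.sub_add_cancel (Nat.one_le_iff_ne_zero.2 hb)] at this
    exact ⟨j, _, Finset.insert_subset hv hTW, this⟩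
  · rw [Function.update_of_ne hj] at hc
    exact ⟨j, T, hTW, hc⟩

open Classical in
theorem card_le_sum_neighbors {V : Type} {G : Bool → SimpleGraph V}
    (hG : ∀ v w, v ≠ w → ∃ i, (G i).Adj v w) (W : Finset V) (v : V) (i : Bool) :
    W.card ≤ 1 + (W.filter ((G i).Adj v)).card + (W.filter ((G (!i)).Adj v)).card := by
  have h : W ⊆ ({v} ∪ W.filter ((G i).Adj v)) ∪ W.filter ((G (!i)).Adj v) := by
    intro w hw
    simp only [Finset.mem_union, Finset.mem_singleton, Finset.mem_filter]
    by_cases hwv : w = v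
    · exact Or.inl (Or.inl hwv)
    · obtain ⟨j, hj⟩ := hG v w (Ne.symm hwv)
      by_cases hji : j = i
      · exact Or.inl (Or.inr ⟨hw, hji ▸ hj⟩)
      · exact Or.inr ⟨hw, (show j = !i by cases i <;> cases j <;> simp_all) ▸ hj⟩
  calc W.card ≤ _ := Finset.card_le_card h
    _ ≤ ({v} ∪ W.filter ((G i).Adj v)).card + _ := Finset.card_union_le _ _
    _ ≤ _ := by
      gcongr
      exact (Finset.card_union_le _ _).trans_eq (by simp)

theorem sum_update_sub_one {b : Bool → ℕ} {i : Bool} (hb : b i ≠ 0) :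
    ∑ j, Function.update b i (b i - 1) j + 1 = ∑ j, b j := by
  rw [Fintype.sum_bool, Fintype.sum_bool]
  cases i <;> simp <;> omega

theorem prod_pow_update_sub_one {b : Bool → ℕ} {i : Bool} (hb : b i ≠ 0) (p : Bool → ℝ) :
    p i * ∏ j, p j ^ Function.update b i (b i - 1) j = ∏ j, p j ^ b j := by
  rw [Fintype.prod_bool, Fintype.prod_bool]
  obtain ⟨c, hc⟩ := Nat.exists_eq_succ_of_ne_zero hb
  cases i <;> simp [hc, pow_succ] <;> ring

open Classical in
/-- The Erdős–Szekeres bound, in weighted form. -/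
theorem hasCliqueIn_of_weights {V : Type} {G : Bool → SimpleGraph V}
    (hG : ∀ v w, v ≠ w → ∃ i, (G i).Adj v w) {p : Bool → ℝ} (hp : ∀ i, 0 < p i)
    (hp1 : p true + p false = 1) (b : Bool → ℕ) (W : Finset V)
    (h : 1 < ((W.card : ℝ) + 1) * ∏ i, p i ^ b i) : HasCliqueIn G W b := by
  induction hn : ∑ i, b i generalizing b W with
  | zero =>
    rw [Fintype.sum_bool] at hn
    exact ⟨true, ∅, Finset.empty_subset _, by
      rw [show b true = 0 by omega]; simp [SimpleGraph.isNClique_iff]⟩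
  | succ n ih =>
    by_cases hb : ∃ i, b i = 0
    · obtain ⟨i, hi⟩ := hb
      exact ⟨i, ∅, Finset.empty_subset _, by rw [hi]; simp [SimpleGraph.isNClique_iff]⟩
    push Not at hb
    have hple : ∀ i, p i ≤ 1 := by
      intro i
      have h1 := hp true
      have h2 := hp false
      cases i <;> linarith
    have hW : W.Nonempty := by
      rw [Finset.nonempty_iff_ne_empty]
      rintro rfl
      have : ∏ i, p i ^ b i ≤ 1 :=
        Finset.prod_le_one (fun i _ => (pow_pos (hp i) _).le)
          fun i _ => pow_le_one₀ (hp i).le (hple i)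
      simp at h
      rw [Fintype.prod_bool] at this
      linarith
    obtain ⟨v, hv⟩ := hW
    by_contra hcon
    -- The shift by 1 makes the induction exact: the vertex `v` itself is paid for by the second 1
    -- when the two bounds are added.
    have key : ∀ i, (((W.filter ((G i).Adj v)).card : ℝ) + 1) * ∏ j, p j ^ b j ≤ p i := by
      intro i
      by_contra! hlt
      refine hcon (HasCliqueIn.of_neighbors hv (hb i) (ih _ _ ?_ ?_))
      · rw [← prod_pow_update_sub_one (hb i)] at hlt
        have := hp i
        by_contra! hle
        nlinarith
      · have := sum_update_sub_one (hb i); omega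
    have h1 : (W.card : ℝ) ≤ 1 + (W.filter ((G true).Adj v)).card +
        (W.filter ((G false).Adj v)).card := by
      exact_mod_cast card_le_sum_neighbors hG W v true
    have h2 : 0 ≤ ∏ j, p j ^ b j := Finset.prod_nonneg fun i _ => (pow_pos (hp i) _).le
    have h3 := mul_le_mul_of_nonneg_right h1 h2
    linarith [key true, key false]

open Classical in
/-- Passing to the majority neighbourhood of vertices of unbalanced degrees, one either runs into
the Erdős–Szekeres bound or arrives at a set all of whose vertices have balanced degrees. -/
theorem hasCliqueIn_of_balanced {V : Type} {G : Bool → SimpleGraph V}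
    (hG : ∀ v w, v ≠ w → ∃ i, (G i).Adj v w) {ε γ : ℝ} (hγ : 0 ≤ γ) (hγε : γ < ε) (S : ℕ) :
    ∀ (W : Finset V) (b : Bool → ℕ), (∀ i, S ≤ b i) →
      (2 : ℝ) ^ (∑ i, b i) ≤ W.card * (1 + γ) ^ S → 2 / (ε - γ) * 2 ^ S ≤ W.card →
      (∀ (W' : Finset V) (b' : Bool → ℕ) (s : ℕ), s ≤ S → (∀ i, b' i ≤ b i) →
        (∀ i, b i ≤ b' i + s) → ∑ i, b' i + s = ∑ i, b i → (W.card : ℝ) ≤ W'.card * 2 ^ s →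
        (∀ v ∈ W', ∀ i, (1 - ε) / 2 * W'.card ≤ (W'.filter ((G i).Adj v)).card) →
        HasCliqueIn G W' b') →
      HasCliqueIn G W b := by
  induction S with
  | zero =>
    intro W b _ hW _ _
    refine hasCliqueIn_of_weights hG (p := fun _ => 1 / 2) (fun _ => by norm_num) (by norm_num) b W ?_
    rw [Finset.prod_pow_eq_pow_sum, one_div, inv_pow, ← div_eq_mul_inv, lt_div_iff₀ (by positivity)]
    simp at hW ⊢
    linarith
  | succ S ih =>
    intro W b hb hW hbig hbal
    by_cases hreg : ∀ v ∈ W, ∀ i, (1 - ε) / 2 * W.card ≤ (W.filter ((G i).Adj v)).card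
    · exact hbal W b 0 (Nat.zero_le _) (fun _ => le_rfl) (fun _ => le_rfl) rfl (by simp) hreg
    push Not at hreg
    obtain ⟨v, hv, i, hi⟩ := hreg
    have hbi : b (!i) ≠ 0 := by have := hb (!i); omega
    set W₁ := W.filter ((G (!i)).Adj v) with hW₁
    have h1 : (W.card : ℝ) ≤ 1 + (W.filter ((G i).Adj v)).card + W₁.card := by
      exact_mod_cast card_le_sum_neighbors hG W v i
    have h2 : 2 / (ε - γ) ≤ W.card := by
      refine le_trans (le_mul_of_one_le_right ?_ (one_le_pow₀ (by norm_num))) hbig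
      exact div_nonneg (by norm_num) (by linarith)
    rw [div_le_iff₀ (by linarith)] at h2
    -- The other colour has more than `(1 + ε) / 2 * |W| - 1` neighbours; the gap between `ε` and
    -- `γ` absorbs the 1.
    have h3 : (1 + γ) / 2 * W.card ≤ W₁.card := by nlinarith
    have h4 : (W.card : ℝ) ≤ W₁.card * 2 := by
      have : 0 ≤ γ * W.card := by positivity
      linarith
    have hsum := sum_update_sub_one hbi
    refine HasCliqueIn.of_neighbors hv hbi (ih _ _ ?_ ?_ ?_ ?_)
    · intro j
      have := hb j
      by_cases hj : j = !i
      · subst hj; simp; omega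
      · rw [Function.update_of_ne hj]; omega
    · rw [← hsum, pow_succ, pow_succ] at hW
      have h5 : (W.card : ℝ) * ((1 + γ) ^ S * (1 + γ)) ≤ W₁.card * (1 + γ) ^ S * 2 := by
        calc (W.card : ℝ) * ((1 + γ) ^ S * (1 + γ)) = (1 + γ) / 2 * W.card * (1 + γ) ^ S * 2 := by
              ring
          _ ≤ _ := by gcongr
      linarith
    · rw [pow_succ] at hbig; linarith
    · intro W' b' s hs hb' hbs hsum' hcard hdeg
      refine hbal W' b' (s + 1) (by omega) ?_ ?_ (by omega) ?_ hdeg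
      · intro j
        have := hb' j
        by_cases hj : j = !i
        · subst hj; simp at this; omega
        · rwa [Function.update_of_ne hj] at this
      · intro j
        have := hbs j
        by_cases hj : j = !i
        · subst hj; simp at this; omega
        · rw [Function.update_of_ne hj] at this; omega
      · rw [pow_succ]; linarith

/-! ### Numerical estimates -/

theorem log_one_sub_bounds :
    -(2.5e-4 + 3.125e-8 + 1.6e-11) ≤ Real.log (1 - 1 / 4000) ∧
      2.5e-4 - 3.125e-8 - 1.6e-11 ≤ Real.log (1 + 1 / 4000) := by
  have h1 := Real.abs_log_sub_add_sum_range_le (x := 1 / 4000) (by norm_num [abs_lt]) 2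
  have h2 := Real.abs_log_sub_add_sum_range_le (x := -(1 / 4000)) (by norm_num [abs_lt]) 2
  rw [abs_le] at h1 h2
  simp only [Finset.sum_range_succ, Finset.sum_range_zero, abs_neg] at h1 h2
  rw [abs_of_pos (by norm_num)] at h1 h2
  rw [sub_neg_eq_add] at h2
  norm_num at h1 h2 ⊢
  constructor <;> linarith [h1.1, h2.1]

theorem exp_neg_twentyone_le : Real.exp (-21) ≤ 5e-9 / 3 := by
  have h1 : (2.718 : ℝ) ^ 21 ≤ Real.exp 21 := by
    rw [show (21 : ℝ) = (21 : ℕ) * 1 by norm_num, Real.exp_nat_mul]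
    gcongr
    linarith [Real.exp_one_gt_d9]
  rw [Real.exp_neg, inv_le_comm₀ (Real.exp_pos _) (by norm_num)]
  refine le_trans ?_ h1
  norm_num

theorem neg_log_five_mul_le : -Real.log 5e-9 ≤ 21 := by
  have h := Real.log_le_log (Real.exp_pos _) (exp_neg_twentyone_le.trans (by norm_num : (5e-9 / 3 : ℝ) ≤ 5e-9))
  rw [Real.log_exp] at h
  linarith

theorem half_min_le_log {u : ℝ} (hu : 0 ≤ u) : min u 1 / 2 ≤ Real.log (1 + u) := by
  have h1 : min u 1 ≤ u := min_le_left _ _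
  have h2 : min u 1 ≤ 1 := min_le_right _ _
  have h3 : 0 ≤ min u 1 := le_min hu zero_le_one
  have h4 := Real.one_sub_inv_le_log_of_pos (show 0 < 1 + min u 1 by linarith)
  have h5 : Real.log (1 + min u 1) ≤ Real.log (1 + u) :=
    Real.log_le_log (by linarith) (by linarith)
  refine le_trans ?_ (h4.trans h5)
  have : 1 - (1 + min u 1)⁻¹ = min u 1 / (1 + min u 1) := by field_simp; ring
  rw [this]
  gcongr
  linarith

/-- For `n - 1 ≤ t` the logarithm is at least linear and `n` dominates `√n`. Beyond that it is at
least 1/2, and the cap on `(n - 1) / t` gives `√n ≤ 1500 * √t`, negligible against `t`. -/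
theorem boost_cost_le {t : ℕ} (ht : 10 ^ 12 ≤ t) {n : ℕ} (hn : 360001 ≤ n)
    (hnt : ((n : ℝ) - 1) / t ≤ Real.exp 2 / (1 / 2 ^ 18)) :
    2 * √(n : ℝ) - Real.log 5e-9 ≤ 1 / 100 * t * Real.log (1 + ((n : ℝ) - 1) / t) := by
  have ht' : (1000000000000 : ℝ) ≤ t :=
    le_trans (by norm_num) (show (10 : ℝ) ^ 12 ≤ t by exact_mod_cast ht)
  have hn' : (360001 : ℝ) ≤ n := by exact_mod_cast hn
  have ht0 : (0 : ℝ) < t := by linarith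
  set s := √(n : ℝ) with hs
  have hsn : s ^ 2 = n := Real.sq_sqrt (by positivity)
  have hs0 : 0 ≤ s := Real.sqrt_nonneg _
  have hs600 : 600 ≤ s := Real.le_sqrt_of_sq_le (by linarith)
  have hu : 0 ≤ ((n : ℝ) - 1) / t := div_nonneg (by linarith) ht0.le
  have h1 := half_min_le_log hu
  have h2 : 1 / 100 * t * (min (((n : ℝ) - 1) / t) 1 / 2) ≤
      1 / 100 * t * Real.log (1 + ((n : ℝ) - 1) / t) := by gcongr
  refine le_trans ?_ h2
  have h3 := neg_log_five_mul_le
  rcases le_total (((n : ℝ) - 1) / t) 1 with h | h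
  · rw [min_eq_left h]
    have : 1 / 100 * (t : ℝ) * (((n : ℝ) - 1) / t / 2) = ((n : ℝ) - 1) / 200 := by
      field_simp; ring
    rw [this]
    nlinarith
  · rw [min_eq_right h]
    have he : Real.exp 2 ≤ 7.5 := by
      rw [show (2 : ℝ) = 1 + 1 by norm_num, Real.exp_add]
      nlinarith [Real.exp_one_lt_d9, Real.exp_pos 1]
    have h4 : ((n : ℝ) - 1) / t ≤ 7.5 * 2 ^ 18 := by
      refine hnt.trans ?_
      rw [div_div_eq_mul_div, div_one]
      gcongr
    rw [div_le_iff₀ ht0] at h4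
    set r := √(t : ℝ) with hr
    have hrt : r ^ 2 = t := Real.sq_sqrt ht0.le
    have hr0 : 10 ^ 6 ≤ r := Real.le_sqrt_of_sq_le (by norm_num; linarith)
    have h5 : s ≤ 1500 * r := by
      refine abs_le_of_sq_le_sq' ?_ (by positivity) |>.2
      rw [hsn, mul_pow, hrt]
      norm_num at h4 ⊢
      linarith
    rw [← hrt]
    nlinarith

theorem one_le_boost {t : ℕ} (ht : 10 ^ 12 ≤ t) {n : ℕ} (hn : 360001 ≤ n) :
    1 ≤ 1.01 / 360000 * t * Real.log (1 + ((n : ℝ) - 1) / t) := by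
  have ht' : (1000000000000 : ℝ) ≤ t :=
    le_trans (by norm_num) (show (10 : ℝ) ^ 12 ≤ t by exact_mod_cast ht)
  have hn' : (360001 : ℝ) ≤ n := by exact_mod_cast hn
  have ht0 : (0 : ℝ) < t := by linarith
  have h1 : Real.log (1 + 360000 / t) ≤ Real.log (1 + ((n : ℝ) - 1) / t) := by
    apply Real.log_le_log (by positivity)
    gcongr
    linarith
  have h2 := Real.one_sub_inv_le_log_of_pos (show (0 : ℝ) < 1 + 360000 / t by positivity)
  have h3 : 1 - (1 + 360000 / (t : ℝ))⁻¹ = 360000 / (t + 360000) := by field_simp; ring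
  rw [h3] at h2
  have h4 : 1 / 1.01 * 360000 / t ≤ 360000 / ((t : ℝ) + 360000) := by
    rw [div_le_div_iff₀ ht0 (by positivity)]
    norm_num
    linarith
  calc (1 : ℝ) = 1.01 / 360000 * t * (1 / 1.01 * 360000 / t) := by field_simp
    _ ≤ _ := by gcongr; linarith

/-! ### Choice of parameters and conclusion -/

-- Per unit of `k`, tilting Erdős–Szekeres on the pages gains about 6.25e-8 net of second-order
-- terms. The book loses about 4.3e-8, unequal `b i` at most about 6.25e-9, and the initial deficit
-- is 1.1e-9.
open Classical in
theorem hasCliqueIn_of_balanced_degrees {V : Type} {G : Bool → SimpleGraph V}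
    (hG : ∀ v w, v ≠ w → ∃ i, (G i).Adj v w) {k S : ℕ} (hk : 10 ^ 16 ≤ k)
    (hS : (S : ℝ) ≤ k / 40000) (W : Finset V) (b : Bool → ℕ) (hbk : ∀ i, b i ≤ k)
    (hkb : ∀ i, k ≤ b i + S) (hW0 : 0 < W.card)
    (hW : (∑ i, b i : ℕ) * Real.log 2 - 1.1e-9 * k ≤ Real.log W.card)
    (hdeg : ∀ v ∈ W, ∀ i, (1 - 5e-5) / 2 * (W.card : ℝ) ≤ (W.filter ((G i).Adj v)).card) :
    HasCliqueIn G W b := by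
  have hk' : (10000000000000000 : ℝ) ≤ k :=
    le_trans (by norm_num) (show (10 : ℝ) ^ 16 ≤ k by exact_mod_cast hk)
  have hW0' : (0 : ℝ) < W.card := by exact_mod_cast hW0
  have hbk' : ∀ i, (b i : ℝ) ≤ k := fun i => by exact_mod_cast hbk i
  have hkb' : ∀ i, (k : ℝ) ≤ b i + S := fun i => by exact_mod_cast hkb i
  have hl2 := Real.log_two_lt_d9
  have hl2' := Real.log_two_gt_d9
  set t := k / 2000 with htdef
  have ht : 10 ^ 12 ≤ t := by omega
  have ht' : (1000000000000 : ℝ) ≤ t :=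
    le_trans (by norm_num) (show (10 : ℝ) ^ 12 ≤ t by exact_mod_cast ht)
  have htk : 2000 * (t : ℝ) ≤ k := by exact_mod_cast Nat.mul_div_le k 2000
  have htk' : (k : ℝ) ≤ 2000 * t + 2000 := by
    have : k ≤ 2000 * t + 2000 := by omega
    exact_mod_cast this
  set p : ℝ := (1 - 5e-5) / 2 - 1 / 2 ^ 18 with hp
  have hp0 : 0 < p := by norm_num [hp]
  set m := ⌈(1 - 5e-5) / 2 * (W.card : ℝ)⌉₊ with hm
  have hlogδ : Real.log (1 / 2 ^ 18) = -18 * Real.log 2 := by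
    rw [one_div, Real.log_inv, Real.log_pow]; norm_num
  have hexc : 1 / 2 ^ 18 ≤ excess p m W := by
    have h1 : (1 - 5e-5) / 2 * (W.card : ℝ) ≤ m := Nat.le_ceil _
    rw [← le_div_iff₀ hW0'] at h1
    rw [excess, hp]
    linarith
  have hlogexc : -18 * Real.log 2 ≤ Real.log (excess p m W) := by
    rw [← hlogδ]; exact Real.log_le_log (by positivity) hexc
  obtain ⟨v, hv⟩ := Finset.card_pos.1 hW0
  -- `n₀` is chosen so that `√n ≤ 600` below it, whence `w = 21 + 2 * 600`. Two spines of size `t`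
  -- then need a little over `2442 * t` of `log |X|`, while `2 * k * log 2` is at least about `2772
  -- * t`.
  obtain ⟨i, T, hTW, M, hMW, ⟨hTcard, hT, hTM⟩, hM0, hM⟩ := exists_book hG (t := t) (n₀ := 360001)
    (by omega) (p := p) (δ := 1 / 2 ^ 18) (κ := 1 / 100) (ν := 1.01 / 360000) (w := 1221) hp0
    (by norm_num [hp]) (by norm_num) (by norm_num) (by norm_num) (by norm_num)
    (fun n hn => by
      have h1 : √(n : ℝ) ≤ 600 := by
        rw [Real.sqrt_le_left (by norm_num)]
        have : (n : ℝ) ≤ 360000 := by exact_mod_cast Nat.le_of_lt_succ hn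
        linarith
      calc Real.exp (-1221) = Real.exp (-21) * Real.exp (-1200) := by
            rw [← Real.exp_add]; norm_num
        _ ≤ 5e-9 / 3 * Real.exp (-2 * √(n : ℝ)) := by
            gcongr
            · exact exp_neg_twentyone_le
            · linarith
        _ = _ := by ring)
    (fun n hn hnt => boost_cost_le ht hn hnt) (fun n hn => one_le_boost ht hn) (by norm_num)
    _ W (fun _ => W) (fun _ => m) (fun _ => t) le_rfl
    (fun i => Nat.ceil_le.2 ((hdeg v hv i).trans (by exact_mod_cast Finset.card_filter_le _ _)))
    (fun i x hx => Nat.ceil_le.2 (hdeg x hx i)) (fun _ => lt_of_lt_of_le (by positivity) hexc)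
    (fun _ => by
      have : 2 * (t : ℝ) / t = 2 := by field_simp
      rw [this, hlogδ]; linarith)
    (by
      rw [Fintype.sum_bool, Fintype.sum_bool]
      rw [Fintype.sum_bool] at hW
      push_cast at hW
      have h1 : (1 / 100 : ℝ) * t * (-18 * Real.log 2) ≤
        1 / 100 * t * Real.log (excess p m W) := by gcongr
      have h2 : (t : ℝ) * Real.log 2 ≤ t * 0.7 := by gcongr; linarith
      have h3 : (1.9 * (k : ℝ)) * 0.69 ≤ ((b true : ℝ) + b false) * Real.log 2 := by
        have := hkb' true
        have := hkb' false
        gcongr <;> linarith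
      linarith)
  have hM0' : (0 : ℝ) < M.card := by exact_mod_cast hM0
  have hlogp : -Real.log p ≤ Real.log 2 + 5.78e-5 := by
    have h1 : Real.log p = Real.log (2 * p) - Real.log 2 := by
      rw [Real.log_mul (by norm_num) hp0.ne']; ring
    have h2 := Real.one_sub_inv_le_log_of_pos (show 0 < 2 * p by positivity)
    have h3 : -5.78e-5 ≤ 1 - (2 * p)⁻¹ := by norm_num [hp]
    have h4 := h3.trans h2
    clear_value p
    linarith only [h1, h4]
  have hlogp0 : 0 ≤ -Real.log p := by
    have := Real.log_nonpos hp0.le (by norm_num [hp]); linarith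
  have hMbound : Real.log W.card - t * (Real.log 2 + 8.61e-5) ≤ Real.log M.card := by
    refine le_trans ?_ hM
    have h1 : (1.01 / 360000 : ℝ) * -Real.log p * t * (-18 * Real.log 2) ≤
        1.01 / 360000 * -Real.log p * t * Real.log (excess p m W) := by gcongr
    have h2 : (1.01 / 360000 : ℝ) * -Real.log p * t * (18 * Real.log 2 + 2) ≤
        1.01 / 360000 * 0.6933 * t * (18 * 0.6932 + 2) := by gcongr <;> linarith
    have h3 : (t : ℝ) * -Real.log p ≤ t * (Real.log 2 + 5.78e-5) := by gcongr
    linarith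
  have hti : t ≤ b i := by
    have : (t : ℝ) ≤ b i := by linarith [hkb' i]
    exact_mod_cast this
  obtain ⟨hlog1, hlog2⟩ := log_one_sub_bounds
  -- The tilt 1/4000 is `t / (2 * k)`, up to rounding of `t`: it maximises `t * x - k * x ^ 2`, the
  -- gain to second order for clique sizes `k - t` and `k`.
  set q : Bool → ℝ := fun j => if j = i then (1 - 1 / 4000) / 2 else (1 + 1 / 4000) / 2 with hq
  have hq0 : ∀ j, 0 < q j := fun j => by simp only [hq]; split_ifs <;> norm_num
  have hclique : HasCliqueIn G M (Function.update b i (b i - t)) := by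
    refine hasCliqueIn_of_weights hG hq0 (by cases i <;> norm_num [hq]) _ _ ?_
    have hprod : ∏ j, q j ^ Function.update b i (b i - t) j =
        ((1 - 1 / 4000) / 2) ^ (b i - t) * ((1 + 1 / 4000) / 2) ^ b (!i) := by
      rw [Fintype.prod_bool]
      cases i <;> simp [hq, mul_comm]
    rw [hprod]
    set Q : ℝ := ((1 - 1 / 4000) / 2) ^ (b i - t) * ((1 + 1 / 4000) / 2) ^ b (!i) with hQ
    have hQ0 : 0 < Q := by positivity
    suffices h : 1 ≤ M.card * Q by linarith
    rw [← Real.log_nonneg_iff (by positivity), Real.log_mul hM0'.ne' hQ0.ne', hQ,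
      Real.log_mul (by positivity) (by positivity), Real.log_pow, Real.log_pow,
      Real.log_div (by norm_num) (by norm_num), Real.log_div (by norm_num) (by norm_num),
      Nat.cast_sub hti]
    have hsum : ((∑ j, b j : ℕ) : ℝ) = b i + b (!i) := by
      rw [Fintype.sum_bool]; push_cast
      cases i <;> simp [add_comm]
    rw [hsum] at hW
    have hti' : (t : ℝ) ≤ b i := by exact_mod_cast hti
    have h1 : ((b i : ℝ) - t) * -(2.5e-4 + 3.125e-8 + 1.6e-11) ≤
        ((b i : ℝ) - t) * Real.log (1 - 1 / 4000) :=
      mul_le_mul_of_nonneg_left hlog1 (by linarith)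
    have h2 : (b (!i) : ℝ) * (2.5e-4 - 3.125e-8 - 1.6e-11) ≤
        (b (!i) : ℝ) * Real.log (1 + 1 / 4000) :=
      mul_le_mul_of_nonneg_left hlog2 (by positivity)
    have h3 := hbk' i
    have h4 := hkb' (!i)
    norm_num at h1 h2 hW hMbound ⊢
    linarith
  obtain ⟨j, T', hT', hc⟩ := hclique
  by_cases hj : j = i
  · subst hj
    rw [Function.update_self] at hc
    refine ⟨j, T ∪ T', Finset.union_subset hTW (hT'.trans hMW), ?_⟩
    have hdisj : Disjoint T T' := Finset.disjoint_left.2 fun x hx hx' =>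
      (hTM x hx x (hT' hx')).ne rfl
    rw [SimpleGraph.isNClique_iff, Finset.card_union_of_disjoint hdisj, hTcard, hc.card_eq]
    refine ⟨?_, by omega⟩
    intro x hx y hy hxy
    rcases Finset.mem_union.1 hx with hx | hx <;> rcases Finset.mem_union.1 hy with hy | hy
    · exact hT hx hy hxy
    · exact hTM x hx y (hT' hy)
    · exact (hTM y hy x (hT' hx)).symm
    · exact hc.isClique hx hy hxy
  · rw [Function.update_of_ne hj] at hc
    exact ⟨j, T', hT'.trans hMW, hc⟩

-- With `S = k / 40000` unbalanced steps the gain `S * log (1 + 4.5e-5)` is about `1.125e-9 * k`,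
-- just above the deficit `1.1e-9 * k`.
open Classical in
theorem hasCliqueIn_diagonal {V : Type} {G : Bool → SimpleGraph V}
    (hG : ∀ v w, v ≠ w → ∃ i, (G i).Adj v w) {k : ℕ} (hk : 10 ^ 16 ≤ k) (W : Finset V)
    (hW0 : 0 < W.card) (hW : 2 * k * Real.log 2 - 1.1e-9 * k ≤ Real.log W.card) :
    HasCliqueIn G W fun _ => k := by
  have hk' : (10000000000000000 : ℝ) ≤ k :=
    le_trans (by norm_num) (show (10 : ℝ) ^ 16 ≤ k by exact_mod_cast hk)
  have hW0' : (0 : ℝ) < W.card := by exact_mod_cast hW0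
  have hl2 := Real.log_two_lt_d9
  have hl2' := Real.log_two_gt_d9
  set S := k / 40000 with hSdef
  have hSk : 40000 * (S : ℝ) ≤ k := by exact_mod_cast Nat.mul_div_le k 40000
  have hSk' : (k : ℝ) ≤ 40000 * S + 40000 := by
    have : k ≤ 40000 * S + 40000 := by omega
    exact_mod_cast this
  refine hasCliqueIn_of_balanced hG (ε := 5e-5) (γ := 4.5e-5) (by norm_num) (by norm_num) S W _
    (fun _ => Nat.div_le_self _ _) ?_ ?_ ?_
  · rw [← Real.log_le_log_iff (by positivity) (by positivity),
      Real.log_mul hW0'.ne' (by positivity), Real.log_pow, Real.log_pow, Fintype.sum_bool]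
    have h1 := Real.one_sub_inv_le_log_of_pos (show (0 : ℝ) < 1 + 4.5e-5 by norm_num)
    have h2 : (4.4997e-5 : ℝ) ≤ Real.log (1 + 4.5e-5) := le_trans (by norm_num) h1
    have h3 : (S : ℝ) * 4.4997e-5 ≤ S * Real.log (1 + 4.5e-5) := by gcongr
    push_cast
    linarith
  · have h1 : (2 / (5e-5 - 4.5e-5) * 2 ^ S : ℝ) ≤ 2 ^ (S + 19) := by
      rw [pow_add, mul_comm]
      gcongr
      norm_num
    refine h1.trans ?_
    rw [← Real.log_le_log_iff (by positivity) hW0', Real.log_pow]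
    push_cast
    have h2 : ((S : ℝ) + 19) * Real.log 2 ≤ (k : ℝ) * Real.log 2 := by gcongr; linarith
    have h3 : (k : ℝ) * 0.69 ≤ k * Real.log 2 := by gcongr; linarith
    linarith
  · intro W' b s hs hb hbs hsum hcard hdeg
    have hW'0 : (0 : ℝ) < W'.card := by
      by_contra! h
      have : (W'.card : ℝ) * 2 ^ s ≤ 0 := mul_nonpos_of_nonpos_of_nonneg h (by positivity)
      linarith
    refine hasCliqueIn_of_balanced_degrees hG hk (S := S) (by linarith) W' b hb
      (fun i => (hbs i).trans (by omega)) (by exact_mod_cast hW'0) ?_ hdeg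
    have h1 := Real.log_le_log hW0' hcard
    rw [Real.log_mul hW'0.ne' (by positivity), Real.log_pow] at h1
    have h2 : ((∑ i, b i : ℕ) : ℝ) + s = 2 * k := by
      rw [Fintype.sum_bool (fun _ => k)] at hsum
      rw [two_mul]; exact_mod_cast hsum
    rw [← eq_sub_iff_add_eq] at h2
    rw [h2]
    linarith

theorem theorem5p8 :
    ∃ k₀ : ℕ, ∀ k : ℕ, k₀ ≤ k →
      (ramseyNumber k : ℝ) ≤ (2 : ℝ) ^ ((2 - (1 / 8000 : ℝ) ^ 2 / 10) * (k : ℝ)) := by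
  refine ⟨10 ^ 16, fun k hk => ?_⟩
  have hk' : (10000000000000000 : ℝ) ≤ k :=
    le_trans (by norm_num) (show (10 : ℝ) ^ 16 ≤ k by exact_mod_cast hk)
  set x : ℝ := (2 : ℝ) ^ ((2 - (1 / 8000 : ℝ) ^ 2 / 10) * (k : ℝ)) with hx
  have hx2 : 2 ≤ x := by
    calc (2 : ℝ) = 2 ^ (1 : ℝ) := by simp
      _ ≤ x := Real.rpow_le_rpow_of_exponent_le (by norm_num) (by norm_num; linarith)
  have hN : x / 2 ≤ (⌊x⌋₊ : ℝ) := by linarith [Nat.sub_one_lt_floor x]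
  have hN0 : 0 < ⌊x⌋₊ := by
    have : (0 : ℝ) < (⌊x⌋₊ : ℝ) := by linarith
    exact_mod_cast this
  suffices h : HasMonoClique ⌊x⌋₊ k by
    calc (ramseyNumber k : ℝ) ≤ (⌊x⌋₊ : ℝ) := by exact_mod_cast Nat.sInf_le h
      _ ≤ x := Nat.floor_le (by linarith)
  intro C
  have hcover : ∀ v w : Fin ⌊x⌋₊, v ≠ w → ∃ i, (C.labelGraph i).Adj v w := fun v w hvw =>
    ⟨C.get v w hvw, by
      rw [SimpleGraph.TopEdgeLabeling.labelGraph_adj]; exact ⟨hvw, rfl⟩⟩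
  -- The required saving `(1 / 8000) ^ 2 / 10 * log 2` is about 1.083e-9, below 1.1e-9; the
  -- difference times `k` covers the `log 2` lost by rounding down.
  obtain ⟨i, T, -, hT⟩ := hasCliqueIn_diagonal hcover hk Finset.univ (by simpa using hN0) (by
    rw [Finset.card_univ, Fintype.card_fin]
    refine le_trans ?_ (Real.log_le_log (by linarith) hN)
    rw [Real.log_div (by linarith) (by norm_num), hx, Real.log_rpow (by norm_num)]
    have h1 : (k : ℝ) * Real.log 2 ≤ k * 0.6932 := by
      gcongr; linarith [Real.log_two_lt_d9]
    have h2 := Real.log_two_lt_d9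
    norm_num
    linarith)
  exact ⟨i, T, hT⟩
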